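/- Let $n,m\ge 1$ be integers, let $\mathbb B^n$ be the open unit ball of $\mathbb R^n$, and let $0<\gamma\le 1$ and $C_0>0$. Let $f:\mathbb B^n\to\mathbb R^m$ belong to the Sobolev space $W^{1,n}(\mathbb B^n,\mathbb R^m)$, i.e. $f\in L^n(\mathbb B^n,\mathbb R^m)$ and $f$ has weak first order partial derivatives in $L^n(\mathbb B^n)$, and suppose that $$|f(z)-f(w)|\le C_0|z-w|^{\gamma}\qquad\text{for all } z,w\in\mathbb B^n .$$ Then $f$ has a (necessarily unique) continuous extension to $\overline{\mathbb B^n}$, still denoted by $f$, and $$\mathcal H^g(f(\partial\mathbb B^n))=0\qquad\text{for the gauge function } g(t)=t^n\log\tfrac1t,\quad g(0)=0 .$$ Here, for $A\subset\mathbb R^m$, $$\mathcal H^g(A)=\lim_{\delta\to0^+}\ \inf\Bigl\{\sum_{i=1}^\infty g(\operatorname{diam}U_i)\ :\ A\subset\bigcup_{i=1}^\infty U_i,\ \operatorname{diam}U_i\le\delta\Bigr\}$$ is the generalized Hausdorff measure with gauge $g$; only the values of $g(t)$ for small $t\ge0$ matter. -/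

import Mathlib

open MeasureTheory Metric Set
open scoped ENNReal ContDiff

/-- `g` is a weak `i`-th partial derivative of `f` in `Ω ⊆ ℝⁿ`: both are locally integrable in `Ω`
and `∫_Ω (∂ᵢ φ) f = - ∫_Ω φ g` for every real test function `φ ∈ C_c^∞(Ω)`. For maps with values
in `ℝᵐ` the integrals are vector-valued, i.e. the identity holds for each component. -/
structure HasWeakPartialDeriv {n m : ℕ} (Ω : Set (EuclideanSpace ℝ (Fin n))) (i : Fin n)
    (f g : EuclideanSpace ℝ (Fin n) → EuclideanSpace ℝ (Fin m)) : Prop where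
  locallyIntegrableOn_fun : LocallyIntegrableOn f Ω
  locallyIntegrableOn_deriv : LocallyIntegrableOn g Ω
  integral_eq : ∀ φ : EuclideanSpace ℝ (Fin n) → ℝ,
    ContDiff ℝ ∞ φ → HasCompactSupport φ → tsupport φ ⊆ Ω →
      ∫ x in Ω, (fderiv ℝ φ x (EuclideanSpace.single i 1)) • f x = - ∫ x in Ω, φ x • g x

/-- The Sobolev class `W^{1,p}(Ω, ℝᵐ)`: `f` is in `L^p(Ω)` and has weak first order partial
derivatives in `L^p(Ω)`. Values of `f` outside `Ω` play no role. -/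
def MemSobolevOne {n m : ℕ} (p : ℝ≥0∞) (Ω : Set (EuclideanSpace ℝ (Fin n)))
    (f : EuclideanSpace ℝ (Fin n) → EuclideanSpace ℝ (Fin m)) : Prop :=
  MemLp f p (volume.restrict Ω) ∧
    ∀ i : Fin n, ∃ g : EuclideanSpace ℝ (Fin n) → EuclideanSpace ℝ (Fin m),
      MemLp g p (volume.restrict Ω) ∧ HasWeakPartialDeriv Ω i f g

/-- The generalized Hausdorff measure on `ℝᵐ` with dimension gauge `h`: the limit as `δ → 0` of the
infimum of `∑ h (diam Uᵢ)` over countable covers by sets of diameter at most `δ`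
(see `MeasureTheory.Measure.mkMetric_apply`). Only the values of `h` near `0` matter. -/
noncomputable def gaugeHausdorffMeasure (m : ℕ) (h : ℝ → ℝ) :
    Measure (EuclideanSpace ℝ (Fin m)) :=
  Measure.mkMetric fun d : ℝ≥0∞ => if d = ⊤ then ⊤ else ENNReal.ofReal (h d.toReal)

/-! The points 2⁻ʲ(k + z), with k in a fine lattice and z in its fundamental cell, discretise the
ball at scale 2⁻ʲ. Each ξ on the sphere is the limit of a chain of such points that follows the
radius to ξ at distance about 2⁻ʲ from the sphere, so the extended value at ξ is the limit of f
along that chain. The n-energy is scale invariant in dimension n. Jensen's inequality along segments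
and averaging over z therefore bound the mean, over z, of the sum of the n-th powers of the
increments of f over all segments near the sphere by a multiple of a finite energy bound
(`lintegral_tsum_segmentIncrement_le`, through the mollifications of
`MemSobolevOne.exists_contDiff_approx`). Hence a single z makes the increments d satisfy ∑ dⁿ < ∞,
for all chains at once. The Hölder condition adds d ≤ C w^(2j) at level j, with w = 2^(-γ/2). The
covering argument is `gaugeHausdorffMeasure_eq_zero_of_chains`. For each u, select the vertices with
d > 2⁻ᵘ wʲ. Past its last selected vertex a chain moves by at most a multiple of 2⁻ᵘ wʲ, so balls of
that radius about the selected vertices cover the image. Selection and Hölder decay give 2⁻ᵘ < C wʲ,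
so the logarithm in the gauge is O(u), and the cover costs O(u aᵤ), where aᵤ is the sum of (2⁻ᵘ wʲ)ⁿ
over selected vertices. A geometric series gives ∑ aᵤ ≤ 2 ∑ dⁿ < ∞. Since the harmonic series
diverges, u aᵤ is arbitrarily small for infinitely many u. -/

/-! ### The gauge, numerical series and the covering criterion -/

/-- The gauge `s ↦ s ^ n * log (1 / s)` is almost monotone near zero. -/
lemma pow_mul_log_one_div_le {n : ℕ} (hn : 1 ≤ n) {s t : ℝ} (hs : 0 ≤ s) (hst : s ≤ t)
    (ht : 0 < t) (ht1 : t ≤ 1) :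
    s ^ n * Real.log (1 / s) ≤ t ^ n * (1 + Real.log (1 / t)) := by
  have hlog : 0 ≤ Real.log (1 / t) := Real.log_nonneg (by rw [le_div_iff₀ ht]; linarith)
  have hsn : s ^ n ≤ t ^ n := pow_le_pow_left₀ hs hst n
  rcases hs.eq_or_lt with rfl | hs
  · simp only [div_zero, Real.log_zero, mul_zero]
    positivity
  have h1 : Real.log (1 / s) = Real.log (t / s) + Real.log (1 / t) := by
    rw [← Real.log_mul (by positivity) (by positivity)]
    congr 1
    field_simp
  have h2 : s ^ n * Real.log (t / s) ≤ t ^ n := by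
    obtain ⟨k, rfl⟩ : ∃ k, n = k + 1 := ⟨n - 1, by omega⟩
    calc s ^ (k + 1) * Real.log (t / s) ≤ s ^ (k + 1) * (t / s) := by
          gcongr
          exact (Real.log_le_sub_one_of_pos (by positivity)).trans (by linarith)
      _ = s ^ k * t := by field_simp; ring
      _ ≤ t ^ k * t := by gcongr
      _ = t ^ (k + 1) := by ring
  rw [h1]
  nlinarith [mul_le_mul_of_nonneg_right hsn hlog]

/-- A ball may have diameter smaller than 2r, so the gauge is compared at two arguments; this is
where its almost monotonicity enters. -/
lemma gauge_ediam_closedBall_le {X : Type*} [PseudoMetricSpace X] {n : ℕ} (hn : 1 ≤ n) (c : X)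
    {r : ℝ} (hr : 0 < r) (hr1 : 2 * r ≤ 1) :
    (if ediam (closedBall c r) = ⊤ then ⊤ else
      ENNReal.ofReal ((ediam (closedBall c r)).toReal ^ n *
        Real.log (1 / (ediam (closedBall c r)).toReal))) ≤
      ENNReal.ofReal ((2 * r) ^ n * (1 + Real.log (1 / (2 * r)))) := by
  rw [if_neg isBounded_closedBall.ediam_ne_top]
  exact ENNReal.ofReal_le_ofReal (pow_mul_log_one_div_le hn ENNReal.toReal_nonneg
    (diam_closedBall hr.le) (by positivity) hr1)

/-- If `∑ a u` converges, then `u * a u` is small infinitely often. -/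
lemma ENNReal.frequently_natCast_mul_le {a : ℕ → ℝ≥0∞} (ha : ∑' u, a u ≠ ⊤) {ε : ℝ≥0∞}
    (hε : ε ≠ 0) : ∃ᶠ u : ℕ in Filter.atTop, u * a u ≤ ε := by
  wlog hε' : ε ≠ ⊤ generalizing ε
  · exact (this (ε := 1) one_ne_zero ENNReal.one_ne_top).mono fun u hu => by
      rw [not_not.1 hε']; exact le_top
  by_contra hcon
  rw [Filter.not_frequently] at hcon
  obtain ⟨N, hN⟩ := Filter.eventually_atTop.1 hcon
  have hau : ∀ u, a u ≠ ⊤ := ENNReal.ne_top_of_tsum_ne_top ha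
  have hsum := ENNReal.summable_toReal ha
  -- Otherwise a u > ε / u for all large u, and the harmonic series would converge. The shift by N +
  -- 1 also avoids the index 0.
  have h2 : Summable fun u : ℕ => ε.toReal * (1 / (u + (N + 1) : ℕ) : ℝ) := by
    refine Summable.of_nonneg_of_le (fun u => by positivity) (fun u => ?_)
      ((summable_nat_add_iff (N + 1)).2 hsum)
    have h3 := (ENNReal.toReal_lt_toReal hε'
      (ENNReal.mul_ne_top (ENNReal.natCast_ne_top _) (hau _))).2
      (not_le.1 (hN (u + (N + 1)) (by omega)))
    rw [ENNReal.toReal_mul, ENNReal.toReal_natCast] at h3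
    rw [mul_one_div, div_le_iff₀ (by positivity), mul_comm]
    exact h3.le
  have h3 := (summable_mul_left_iff (ENNReal.toReal_ne_zero.2 ⟨hε, hε'⟩)).1 h2
  exact Real.not_summable_one_div_natCast
    ((summable_nat_add_iff (f := fun u : ℕ => (1 / u : ℝ)) (N + 1)).1 h3)

/-- The sum of the geometric sequence `(2⁻ᵘ b) ^ n` over the indices where `2⁻ᵘ b < d` is
comparable with its first term. -/
lemma tsum_geometric_below_le {n : ℕ} (hn : 1 ≤ n) {b d : ℝ} (hb : 0 ≤ b) :
    ∑' u : ℕ, (if (1 / 2 : ℝ) ^ u * b < d then ENNReal.ofReal (((1 / 2 : ℝ) ^ u * b) ^ n) else 0)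
      ≤ 2 * ENNReal.ofReal (d ^ n) := by
  by_cases hex : ∃ u : ℕ, (1 / 2 : ℝ) ^ u * b < d
  swap
  · push Not at hex
    simp only [fun u => not_lt.2 (hex u), if_false, tsum_zero, zero_le]
  classical
  set N := Nat.find hex
  have hN : (1 / 2 : ℝ) ^ N * b < d := Nat.find_spec hex
  have hd : 0 ≤ d := le_trans (by positivity) hN.le
  rw [← ENNReal.summable.sum_add_tsum_nat_add' (k := N), Finset.sum_eq_zero, zero_add]
  · calc _ ≤ ∑' u : ℕ, ENNReal.ofReal ((1 / 2 : ℝ) ^ u * d ^ n) := by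
          refine ENNReal.tsum_le_tsum fun u => ?_
          split_ifs
          · refine ENNReal.ofReal_le_ofReal ?_
            have : (1 / 2 : ℝ) ^ (u + N) * b = (1 / 2) ^ u * ((1 / 2) ^ N * b) := by ring
            rw [this, mul_pow]
            gcongr
            exact pow_le_of_le_one (by positivity) (pow_le_one₀ (by norm_num) (by norm_num))
              (by omega)
          · exact zero_le
      _ = ENNReal.ofReal (∑' u : ℕ, (1 / 2 : ℝ) ^ u * d ^ n) :=
          (ENNReal.ofReal_tsum_of_nonneg (fun u => by positivity)
            (summable_geometric_two.mul_right _)).symm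
      _ = 2 * ENNReal.ofReal (d ^ n) := by
          rw [tsum_mul_right, tsum_geometric_two, ENNReal.ofReal_mul (by norm_num)]
          simp
  · intro u hu
    exact if_neg (Nat.find_min hex (Finset.mem_range.1 hu))

open Filter Topology in
/-- A chain `x` whose steps of index `> j` are at most `t * w ^ i` stays close to `x j`. -/
lemma dist_limit_le_of_geometric {V : Type*} [SeminormedAddCommGroup V] {w t : ℝ} (hw : 0 < w)
    (hw1 : w < 1) (ht : 0 ≤ t) {x : ℕ → V} {a : V} (hx : Tendsto x atTop (𝓝 a)) (j : ℕ)
    (hstep : ∀ i, j ≤ i → ‖x (i + 1) - x i‖ ≤ t * w ^ (i + 1)) :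
    ‖a - x j‖ ≤ w / (1 - w) * (t * w ^ j) := by
  have hw' : 0 < 1 - w := by linarith
  have key : ∀ p, ‖x (j + p) - x j‖ ≤ w / (1 - w) * (t * (w ^ j - w ^ (j + p))) := by
    intro p
    induction p with
    | zero => simp
    | succ p ih =>
      have h1 : ‖x (j + (p + 1)) - x j‖ ≤ ‖x (j + p + 1) - x (j + p)‖ + ‖x (j + p) - x j‖ := by
        rw [← add_assoc]
        exact norm_sub_le_norm_sub_add_norm_sub _ _ _
      have h2 := hstep (j + p) (by omega)
      have h3 : w / (1 - w) * (t * (w ^ j - w ^ (j + (p + 1)))) =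
          t * w ^ (j + p + 1) + w / (1 - w) * (t * (w ^ j - w ^ (j + p))) := by
        field_simp
        ring
      linarith
  have hlim : Tendsto (fun p => ‖x (j + p) - x j‖) atTop (𝓝 ‖a - x j‖) :=
    ((hx.comp (tendsto_atTop_mono (fun p => Nat.le_add_left p j) tendsto_id)).sub_const _).norm
  refine le_of_tendsto' hlim fun p => (key p).trans ?_
  gcongr
  have : 0 ≤ w ^ (j + p) := by positivity
  linarith

open Filter Topology in
/-- A covering criterion for the gauge `t ^ n * log (1 / t)`. The points of `A` are limits of chains
of centres `c (q j)`, with increments `d (q j)` that are `n`-summable over all vertices and decay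
geometrically with the level. -/
lemma gaugeHausdorffMeasure_eq_zero_of_chains {n m : ℕ} (hn : 1 ≤ n) {ι : Type*} [Countable ι]
    (lev : ι → ℕ) (c : ι → EuclideanSpace ℝ (Fin m)) (d : ι → ℝ)
    (hsum : ∑' i, ENNReal.ofReal (d i ^ n) ≠ ⊤) {w C : ℝ} (hw : 0 < w) (hw1 : w < 1)
    (hdecay : ∀ i, d i ≤ C * (w ^ lev i * w ^ lev i)) {A : Set (EuclideanSpace ℝ (Fin m))}
    (hA : ∀ a ∈ A, ∃ q : ℕ → ι, (∀ j, lev (q j) = j) ∧ 1 ≤ d (q 0) ∧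
      (∀ j, ‖c (q (j + 1)) - c (q j)‖ ≤ d (q (j + 1))) ∧
      Tendsto (fun j => c (q j)) atTop (𝓝 a)) :
    gaugeHausdorffMeasure m (fun t => t ^ n * Real.log (1 / t)) A = 0 := by
  wlog hC : 0 < C generalizing C
  · exact this (C := 1) (fun i => (hdecay i).trans (by gcongr; linarith)) one_pos
  set M := w / (1 - w) with hM
  have hM0 : 0 < M := div_pos hw (by linarith)
  let sel : ℕ → ι → Prop := fun u i => (1 / 2 : ℝ) ^ u * w ^ lev i < d i
  classical
  let a : ℕ → ℝ≥0∞ := fun u =>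
    ∑' i, if sel u i then ENNReal.ofReal (((1 / 2 : ℝ) ^ u * w ^ lev i) ^ n) else 0
  have ha : ∑' u, a u ≠ ⊤ := by
    have : ∑' u, a u ≤ ∑' i, 2 * ENNReal.ofReal (d i ^ n) := by
      rw [ENNReal.tsum_comm]
      exact ENNReal.tsum_le_tsum fun i => tsum_geometric_below_le hn (by positivity)
    rw [ENNReal.tsum_mul_left] at this
    exact ne_top_of_le_ne_top (ENNReal.mul_ne_top (by simp) hsum) this
  -- The logarithm below is at most 2 u log 2 plus a constant; with u ≥ 1 and log 2 ≤ 1 this is at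
  -- most K u.
  set K : ℝ := 2 + |1 + Real.log C - Real.log (2 * M)|
  have hK : 0 < K := by positivity
  let S : ℕ → ι → Set (EuclideanSpace ℝ (Fin m)) := fun u i =>
    if sel u i then closedBall (c i) (M * ((1 / 2 : ℝ) ^ u * w ^ lev i)) else ∅
  have hsmall : Tendsto (fun u : ℕ => 2 * M * (1 / 2 : ℝ) ^ u) atTop (𝓝 0) := by
    simpa using (tendsto_pow_atTop_nhds_zero_of_lt_one (by norm_num : (0 : ℝ) ≤ 1 / 2)
      (by norm_num)).const_mul (2 * M)
  have hwl : ∀ i, w ^ lev i ≤ 1 := fun i => pow_le_one₀ hw.le hw1.le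
  have hcost : ∀ᶠ u : ℕ in atTop, ∑' i, (fun e : ℝ≥0∞ => if e = ⊤ then ⊤ else
      ENNReal.ofReal (e.toReal ^ n * Real.log (1 / e.toReal))) (ediam (S u i)) ≤
      ENNReal.ofReal ((2 * M) ^ n * K) * (u * a u) := by
    filter_upwards [hsmall.eventually_le_const one_pos, eventually_ge_atTop 1] with u hu hu1
    simp only [a]
    rw [← ENNReal.tsum_mul_left, ← ENNReal.tsum_mul_left]
    refine ENNReal.tsum_le_tsum fun i => ?_
    by_cases hs : sel u i
    swap
    · simp [S, hs, show n ≠ 0 by omega]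
    simp only [S, hs, if_true]
    set y := (1 / 2 : ℝ) ^ u * w ^ lev i with hy
    have hy0 : 0 < y := by positivity
    have hy1 : 2 * (M * y) ≤ 1 := by
      refine le_trans ?_ hu
      rw [← mul_assoc, hy]
      gcongr
      exact mul_le_of_le_one_right (by positivity) (hwl i)
    refine (gauge_ediam_closedBall_le hn (c i) (by positivity) hy1).trans ?_
    rw [← ENNReal.ofReal_natCast, ← ENNReal.ofReal_mul (by positivity),
      ← ENNReal.ofReal_mul (by positivity)]
    refine ENNReal.ofReal_le_ofReal ?_
    have hlog : 1 + Real.log (1 / (2 * (M * y))) ≤ K * u := by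
      have e1 : Real.log (1 / (2 * (M * y))) =
          u * Real.log 2 - Real.log (w ^ lev i) - Real.log (2 * M) := by
        have e3 : Real.log y = Real.log (w ^ lev i) - u * Real.log 2 := by
          rw [hy, Real.log_mul (by positivity) (by positivity), Real.log_pow, one_div,
            Real.log_inv]
          ring
        rw [← mul_assoc, one_div, Real.log_inv, Real.log_mul (by positivity) hy0.ne', e3]
        ring
      -- Selection and decay give 2⁻ᵘ w^lev < d ≤ C w^(2 lev). One factor w^lev cancels, and the
      -- other is thereby bounded below in terms of u alone.
      have e2 : - Real.log (w ^ lev i) ≤ Real.log C + u * Real.log 2 := by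
        have h1 : (1 / 2 : ℝ) ^ u < C * w ^ lev i := by
          have h2 := lt_of_lt_of_le hs (hdecay i)
          rw [← mul_assoc] at h2
          exact lt_of_mul_lt_mul_right h2 (by positivity)
        have h3 := Real.log_le_log (by positivity) h1.le
        rw [Real.log_mul hC.ne' (by positivity), Real.log_pow, one_div, Real.log_inv] at h3
        linarith
      have h2 : Real.log 2 ≤ 1 := by linarith [Real.log_two_lt_d9]
      have hu' : (1 : ℝ) ≤ u := by exact_mod_cast hu1
      have h4 := le_abs_self (1 + Real.log C - Real.log (2 * M))
      have h5 := abs_nonneg (1 + Real.log C - Real.log (2 * M))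
      simp only [K]
      rw [e1]
      nlinarith
    calc (2 * (M * y)) ^ n * (1 + Real.log (1 / (2 * (M * y))))
        ≤ (2 * (M * y)) ^ n * (K * u) := by gcongr
      _ = _ := by ring
  have hle : gaugeHausdorffMeasure m (fun t => t ^ n * Real.log (1 / t)) A ≤
      liminf (fun u => ∑' i, (fun e : ℝ≥0∞ => if e = ⊤ then ⊤ else
        ENNReal.ofReal (e.toReal ^ n * Real.log (1 / e.toReal))) (ediam (S u i))) atTop := by
    refine Measure.mkMetric_le_liminf_tsum (ι := fun _ => ι) A
      (fun u : ℕ => ENNReal.ofReal (2 * M * (1 / 2 : ℝ) ^ u)) ?_ S ?_ ?_ _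
    · simpa using ENNReal.tendsto_ofReal hsmall
    · refine Eventually.of_forall fun u i => ?_
      by_cases hs : sel u i
      swap
      · simp [S, hs]
      simp only [S, hs, if_true]
      rw [← ENNReal.ofReal_toReal (isBounded_closedBall.ediam_ne_top)]
      refine ENNReal.ofReal_le_ofReal ((diam_closedBall (by positivity)).trans ?_)
      rw [← mul_assoc]
      gcongr
      exact mul_le_of_le_one_right (by positivity) (hwl i)
    · filter_upwards [eventually_ge_atTop 1] with u hu z hz
      obtain ⟨q, hq, hq0, hstep, hlim⟩ := hA z hz
      -- For fixed u the increments decay like w^(2j) and the threshold only like wʲ, so a chain has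
      -- a last selected vertex.
      have hfin : ∃ N, ∀ j, N ≤ j → ¬ sel u (q j) := by
        have h1 : Tendsto (fun j => C * w ^ j) atTop (𝓝 0) := by
          simpa using (tendsto_pow_atTop_nhds_zero_of_lt_one hw.le hw1).const_mul C
        obtain ⟨N, hN⟩ := eventually_atTop.1
          (h1.eventually_le_const (show (0 : ℝ) < (1 / 2) ^ u by positivity))
        refine ⟨N, fun j hj => not_lt.2 ?_⟩
        refine (hdecay _).trans ?_
        rw [hq, ← mul_assoc]
        gcongr
        exact hN j hj
      -- The root has increment at least 1 > 2⁻ᵘ, so some vertex of the chain is selected.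
      have h0 : sel u (q 0) := by
        refine lt_of_lt_of_le ?_ hq0
        rw [hq, pow_zero, mul_one]
        exact pow_lt_one₀ (by norm_num) (by norm_num) (by omega)
      obtain ⟨N, hN⟩ := hfin
      set j := Nat.findGreatest (fun j => sel u (q j)) N
      have hj : sel u (q j) := Nat.findGreatest_spec (P := fun j => sel u (q j)) (Nat.zero_le N) h0
      have hj' : ∀ i, j < i → ¬ sel u (q i) := by
        intro i hi
        rcases le_total i N with h | h
        · exact Nat.findGreatest_is_greatest hi h
        · exact hN i h
      refine mem_iUnion.2 ⟨q j, ?_⟩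
      simp only [S, hj, if_true, mem_closedBall, dist_eq_norm, hq]
      refine dist_limit_le_of_geometric hw hw1 (by positivity) hlim j fun i hi => ?_
      refine (hstep i).trans ?_
      have := not_lt.1 (hj' (i + 1) (by omega))
      rwa [hq] at this
  refine le_antisymm (hle.trans (le_of_forall_pos_le_add fun ε hε => ?_)) zero_le
  rw [zero_add]
  set κ := ENNReal.ofReal ((2 * M) ^ n * K)
  have hκ0 : κ ≠ 0 := by simp only [κ, ne_eq, ENNReal.ofReal_eq_zero, not_le]; positivity
  have hκ : κ ≠ ⊤ := ENNReal.ofReal_ne_top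
  refine liminf_le_of_frequently_le' (((ENNReal.frequently_natCast_mul_le ha
    (ε := ε / κ) (ENNReal.div_pos hε.ne' hκ).ne').and_eventually hcost).mono ?_)
  rintro u ⟨h1, h2⟩
  exact h2.trans ((mul_le_mul_right h1 κ).trans (ENNReal.mul_div_le))

/-- Jensen's inequality for powers of a lower integral. -/
lemma lintegral_pow_le_of_isProbabilityMeasure {α : Type*} [MeasurableSpace α] (μ : Measure α)
    [IsProbabilityMeasure μ] {n : ℕ} (hn : 1 ≤ n) {h : α → ℝ≥0∞} (hh : AEMeasurable h μ) :
    (∫⁻ x, h x ∂μ) ^ n ≤ ∫⁻ x, h x ^ n ∂μ := by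
  have h1 : eLpNorm' h 1 μ ≤ eLpNorm' h n μ :=
    eLpNorm'_le_eLpNorm'_of_exponent_le one_pos (by exact_mod_cast hn) μ
      hh.aestronglyMeasurable
  have h2 : ∫⁻ x, h x ∂μ ≤ (∫⁻ x, h x ^ n ∂μ) ^ (1 / (n : ℝ)) := by
    simpa [eLpNorm'] using h1
  calc _ ≤ ((∫⁻ x, h x ^ n ∂μ) ^ (1 / (n : ℝ))) ^ n := by gcongr
    _ = _ := by
      rw [← ENNReal.rpow_natCast, ← ENNReal.rpow_mul, one_div_mul_cancel
        (by positivity), ENNReal.rpow_one]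

/-! ### Increments along a segment -/

section FundamentalTheorem

variable {E V : Type*} [NormedAddCommGroup E] [NormedSpace ℝ E]
  [NormedAddCommGroup V] [NormedSpace ℝ V]

/-- The fundamental theorem of calculus on the segment, then Jensen on the probability space [0, 1].
-/
lemma enorm_sub_pow_le_lintegral_fderiv [CompleteSpace V] {n : ℕ} (hn : 1 ≤ n) {u : E → V}
    (hu : ContDiff ℝ 1 u) (x v : E) :
    ‖u (x + v) - u x‖ₑ ^ n ≤
      ∫⁻ s in Icc (0 : ℝ) 1, ‖fderiv ℝ u (x + s • v)‖ₑ ^ n * ‖v‖ₑ ^ n := by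
  have hder : ∀ s : ℝ, HasDerivAt (fun s : ℝ => u (x + s • v)) (fderiv ℝ u (x + s • v) v) s := by
    intro s
    have h1 : HasDerivAt (fun s : ℝ => x + s • v) v s := by
      simpa using ((hasDerivAt_id s).smul_const v).const_add x
    exact ((hu.differentiable one_ne_zero) _).hasFDerivAt.comp_hasDerivAt s h1
  have hcd : ContDiff ℝ 1 (fun s : ℝ => u (x + s • v)) := by fun_prop
  have h1 := enorm_sub_le_lintegral_deriv_of_contDiffOn_Icc (hcd.contDiffOn (s := Icc 0 1))
    zero_le_one
  simp only [zero_smul, add_zero, one_smul] at h1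
  have hprob : IsProbabilityMeasure (volume.restrict (Icc (0 : ℝ) 1)) := ⟨by simp⟩
  calc ‖u (x + v) - u x‖ₑ ^ n
      ≤ (∫⁻ s in Icc (0 : ℝ) 1, ‖deriv (fun s : ℝ => u (x + s • v)) s‖ₑ) ^ n := by gcongr
    _ ≤ ∫⁻ s in Icc (0 : ℝ) 1, ‖deriv (fun s : ℝ => u (x + s • v)) s‖ₑ ^ n :=
        lintegral_pow_le_of_isProbabilityMeasure _ hn
          (hcd.continuous_deriv le_rfl).enorm.measurable.aemeasurable
    _ ≤ _ := by
        refine lintegral_mono fun s => ?_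
        rw [(hder s).deriv, ← mul_pow]
        gcongr
        exact ContinuousLinearMap.le_opENorm _ _

end FundamentalTheorem

/-! ### Averaging over translated lattice cells -/

section Lattice

open Module Submodule

variable {E : Type*} [NormedAddCommGroup E] [NormedSpace ℝ E] [FiniteDimensional ℝ E]
  [MeasurableSpace E] [BorelSpace E] (μ : Measure E) [μ.IsAddHaarMeasure]

lemma lintegral_comp_smul_eq (h : E → ℝ≥0∞) {r : ℝ} (hr : 0 < r) :
    ∫⁻ x, h (r • x) ∂μ = (ENNReal.ofReal r ^ finrank ℝ E)⁻¹ * ∫⁻ x, h x ∂μ := by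
  have h1 := (Homeomorph.smulOfNeZero r hr.ne' : E ≃ₜ E).toMeasurableEquiv.measurableEmbedding
    |>.lintegral_map (μ := μ) h
  have h2 := Measure.map_addHaar_smul μ hr.ne'
  change ∫⁻ x, h x ∂(Measure.map (r • ·) μ) = ∫⁻ x, h (r • x) ∂μ at h1
  rw [← h1, h2, lintegral_smul_measure, smul_eq_mul, abs_of_pos (by positivity),
    ENNReal.ofReal_inv_of_pos (by positivity), ENNReal.ofReal_pow hr.le]

variable {ι : Type*} [Finite ι] (b : Basis ι ℝ E)

-- The cell is star-shaped about its corner 0, so a shrunk cell stays inside it and translates of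
-- shrunk cells remain disjoint.
omit [FiniteDimensional ℝ E] [MeasurableSpace E] [BorelSpace E] [Finite ι] in
lemma ZSpan.smul_mem_fundamentalDomain {θ : ℝ} (hθ : 0 ≤ θ) (hθ1 : θ ≤ 1) {x : E}
    (hx : x ∈ ZSpan.fundamentalDomain b) : θ • x ∈ ZSpan.fundamentalDomain b := by
  intro i
  have h := hx i
  simp only [map_smul, Finsupp.smul_apply, smul_eq_mul, mem_Ico] at h ⊢
  exact ⟨mul_nonneg hθ h.1, lt_of_le_of_lt (mul_le_of_le_one_left h.1 hθ1) h.2⟩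

/-- Summing over the lattice the integrals over shrunk and rescaled cells costs only the
Jacobian. -/
lemma tsum_lintegral_lattice_cells_le (h : E → ℝ≥0∞) {θ τ : ℝ} (hθ : 0 < θ) (hθ1 : θ ≤ 1)
    (hτ : 0 < τ) (a : E) :
    ∑' k : span ℤ (range b), ∫⁻ z in ZSpan.fundamentalDomain b, h (τ • (k + θ • z + a)) ∂μ ≤
      (ENNReal.ofReal (θ * τ) ^ finrank ℝ E)⁻¹ * ∫⁻ x, h x ∂μ := by
  have hmeas := ZSpan.fundamentalDomain_measurableSet b
  set D := ZSpan.fundamentalDomain b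
  set H : E → ℝ≥0∞ := fun y => h (τ • (y + a))
  have hcell : ∀ k : E, ∫⁻ z in D, H (k + θ • z) ∂μ ≤
      (ENNReal.ofReal θ ^ finrank ℝ E)⁻¹ * ∫⁻ z in D, H (k + z) ∂μ := by
    intro k
    rw [← lintegral_indicator hmeas, ← lintegral_indicator hmeas, ← lintegral_comp_smul_eq μ _ hθ]
    refine lintegral_mono fun z => ?_
    by_cases hz : z ∈ D
    · rw [indicator_of_mem hz,
        indicator_of_mem (ZSpan.smul_mem_fundamentalDomain b hθ.le hθ1 hz)]
    · rw [indicator_of_notMem hz]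
      exact zero_le
  have hH : ∫⁻ y, H y ∂μ = (ENNReal.ofReal τ ^ finrank ℝ E)⁻¹ * ∫⁻ x, h x ∂μ := by
    rw [← lintegral_comp_smul_eq μ h hτ]
    exact lintegral_add_right_eq_self (fun y => h (τ • y)) a
  calc _ ≤ ∑' k : span ℤ (range b),
        (ENNReal.ofReal θ ^ finrank ℝ E)⁻¹ * ∫⁻ z in D, H (k + z) ∂μ :=
        ENNReal.tsum_le_tsum fun k => hcell k
    _ = (ENNReal.ofReal θ ^ finrank ℝ E)⁻¹ * ∫⁻ y, H y ∂μ := by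
        have : VAddInvariantMeasure (span ℤ (range b)) E μ :=
          inferInstanceAs <| VAddInvariantMeasure (span ℤ (Set.range b)).toAddSubgroup E μ
        rw [ENNReal.tsum_mul_left, (ZSpan.isAddFundamentalDomain b μ).lintegral_eq_tsum'' H]
        rfl
    _ = _ := by
        rw [hH, ← mul_assoc, ENNReal.ofReal_mul hθ.le, mul_pow, ENNReal.mul_inv]
        · exact Or.inr (by finiteness)
        · exact Or.inl (by finiteness)

end Lattice

/-! ### Lattice segments in dyadic annuli -/

section Segments

open Module Submodule

variable {E : Type*} [NormedAddCommGroup E] [NormedSpace ℝ E]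

/-- The segment joining the point `2⁻ʲ (k + z)` of a lattice cell to the point
`2⁻ʲ⁻¹ (2 k + l + z)` of a cell of the next generation. -/
noncomputable def latticeSegment (j : ℕ) (k l z : E) (s : ℝ) : E :=
  (1 / 2 : ℝ) ^ j • (k + (1 - s / 2) • z + (s / 2) • l)

/-- The dyadic annulus of width about `2⁻ʲ` at distance about `2⁻ʲ` from the unit sphere. -/
def dyadicAnnulus (E : Type*) [NormedAddCommGroup E] (j : ℕ) : Set E :=
  {x | (1 / 4) * (1 / 2 : ℝ) ^ j < 1 - ‖x‖ ∧ 1 - ‖x‖ < 2 * (1 / 2 : ℝ) ^ j}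

/-- All segments with the given lattice data, issuing from the standard cell, lie in `S`. -/
def SegmentsSubset {ι : Type*} (b : Basis ι ℝ E) (S : Set E) (j : ℕ) (k l : E) : Prop :=
  ∀ z ∈ ZSpan.fundamentalDomain b, ∀ s ∈ Icc (0 : ℝ) 1, latticeSegment j k l z s ∈ S

lemma latticeSegment_eq (j : ℕ) (k l z : E) (s : ℝ) :
    latticeSegment j k l z s = latticeSegment j k l z 0 +
      s • (latticeSegment j k l z 1 - latticeSegment j k l z 0) := by
  simp only [latticeSegment]
  module

lemma latticeSegment_one_sub_zero (j : ℕ) (k l z : E) :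
    latticeSegment j k l z 1 - latticeSegment j k l z 0 =
      ((1 / 2 : ℝ) ^ j * (1 / 2)) • (l - z) := by
  simp only [latticeSegment]
  module

@[fun_prop]
lemma Measurable.latticeSegment [MeasurableSpace E] [BorelSpace E] [FiniteDimensional ℝ E]
    {α : Type*} [MeasurableSpace α] (j : ℕ) (k l : E) {f : α → E} {g : α → ℝ} (hf : Measurable f)
    (hg : Measurable g) : Measurable fun x => latticeSegment j k l (f x) (g x) := by
  have : Continuous fun p : E × ℝ => _root_.latticeSegment j k l p.1 p.2 := by
    unfold _root_.latticeSegment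
    fun_prop
  exact this.measurable.comp (hf.prodMk hg)

omit [NormedSpace ℝ E] in
lemma isOpen_dyadicAnnulus (j : ℕ) : IsOpen (dyadicAnnulus E j) := by
  have h : Continuous fun x : E => 1 - ‖x‖ := by fun_prop
  exact (isOpen_lt continuous_const h).inter (isOpen_lt h continuous_const)

-- The annuli overlap, but each lies in three consecutive members of a disjoint family of dyadic
-- shells; hence the factor 3.
omit [NormedSpace ℝ E] in
lemma tsum_lintegral_dyadicAnnulus_le [MeasurableSpace E] [BorelSpace E] (μ : Measure E)
    (h : E → ℝ≥0∞) : ∑' j : ℕ, ∫⁻ x in dyadicAnnulus E j, h x ∂μ ≤ 3 * ∫⁻ x, h x ∂μ := by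
  set c : ℕ → ℝ := fun i => 2 * (1 / 2 : ℝ) ^ i with hc
  have hanti : Antitone c := fun i j hij => by
    simp only [c]
    gcongr 2 * ?_
    exact pow_le_pow_of_le_one (by norm_num) (by norm_num) hij
  set D : ℕ → Set E := fun i => {x | 1 - ‖x‖ ∈ Ico (c (i + 1)) (c i)}
  have hD : ∀ i, MeasurableSet (D i) := fun i =>
    (by fun_prop : Continuous fun x : E => 1 - ‖x‖).measurable measurableSet_Ico
  have hdisj : Pairwise (Function.onFun Disjoint D) := fun i j hij =>
    (hanti.pairwise_disjoint_on_Ico_succ hij).preimage _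
  have htot : ∑' i, ∫⁻ x in D i, h x ∂μ ≤ ∫⁻ x, h x ∂μ := by
    rw [← lintegral_iUnion hD hdisj]
    exact setLIntegral_le_lintegral _ _
  have hshift : ∀ p : ℕ, ∑' j, ∫⁻ x in D (j + p), h x ∂μ ≤ ∫⁻ x, h x ∂μ := fun p =>
    (ENNReal.tsum_comp_le_tsum_of_injective (add_left_injective p)
      fun i => ∫⁻ x in D i, h x ∂μ).trans htot
  have hsub : ∀ j, dyadicAnnulus E j ⊆ D j ∪ (D (j + 1) ∪ D (j + 2)) := by
    rintro j x ⟨h1, h2⟩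
    simp only [D, c, mem_union, mem_ofPred_eq, mem_Ico, pow_succ]
    grind
  calc _ ≤ ∑' j, (∫⁻ x in D (j + 0), h x ∂μ +
        (∫⁻ x in D (j + 1), h x ∂μ + ∫⁻ x in D (j + 2), h x ∂μ)) := by
        refine ENNReal.tsum_le_tsum fun j => (lintegral_mono_set (hsub j)).trans ?_
        exact (lintegral_union_le _ _ _).trans (add_le_add_right (lintegral_union_le _ _ _) _)
    _ ≤ _ := by
        rw [ENNReal.tsum_add, ENNReal.tsum_add]
        refine (add_le_add (hshift 0) (add_le_add (hshift 1) (hshift 2))).trans (le_of_eq ?_)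
        ring

variable [FiniteDimensional ℝ E] [MeasurableSpace E] [BorelSpace E] (μ : Measure E)
  [μ.IsAddHaarMeasure] {ι : Type*} [Finite ι] (b : Basis ι ℝ E)
  {V : Type*} [NormedAddCommGroup V] [NormedSpace ℝ V] [CompleteSpace V]

/-- The increments of a `C¹` function along the lattice segments of generation `j` inside `S`
are controlled by the energy on `S`. -/
lemma tsum_lintegral_enorm_sub_le_of_generation (hn : 1 ≤ finrank ℝ E)
    (hb : ∀ z ∈ ZSpan.fundamentalDomain b, ‖z‖ ≤ 1) {u : E → V} (hu : ContDiff ℝ 1 u) {S : Set E}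
    (hS : MeasurableSet S) (j : ℕ) {l : E} (hl : ‖l‖ ≤ 2) :
    ∑' k : span ℤ (range b), ∫⁻ z in ZSpan.fundamentalDomain b,
      {_z | SegmentsSubset b S j k l}.indicator (fun z =>
        ‖u (latticeSegment j k l z 1) - u (latticeSegment j k l z 0)‖ₑ ^ finrank ℝ E) z ∂μ ≤
      4 ^ finrank ℝ E * ∫⁻ x in S, ‖fderiv ℝ u x‖ₑ ^ finrank ℝ E ∂μ := by
  set n := finrank ℝ E
  have hmeas := ZSpan.fundamentalDomain_measurableSet b
  set D := ZSpan.fundamentalDomain b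
  set τ : ℝ := (1 / 2 : ℝ) ^ j
  have hτ : 0 < τ := by positivity
  set h : E → ℝ≥0∞ := S.indicator fun x => ‖fderiv ℝ u x‖ₑ ^ n
  have hh : Measurable h :=
    ((hu.continuous_fderiv one_ne_zero).enorm.measurable.pow_const n).indicator hS
  -- R bounds the n-th power of the segment length, which is τ/2 · ‖l - z‖ ≤ 3τ/2.
  set R : ℝ≥0∞ := ENNReal.ofReal (2 * τ) ^ n
  have hstep : ∀ k : E, ∀ z ∈ D, {_z | SegmentsSubset b S j k l}.indicator (fun z =>
      ‖u (latticeSegment j k l z 1) - u (latticeSegment j k l z 0)‖ₑ ^ n) z ≤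
      ∫⁻ s in Icc (0 : ℝ) 1, h (latticeSegment j k l z s) * R := by
    intro k z hz
    by_cases hk : SegmentsSubset b S j k l
    swap
    · rw [indicator_of_notMem (by simpa using hk)]
      exact zero_le
    rw [indicator_of_mem (by simpa using hk)]
    have h1 := enorm_sub_pow_le_lintegral_fderiv hn hu (latticeSegment j k l z 0)
      (latticeSegment j k l z 1 - latticeSegment j k l z 0)
    rw [add_sub_cancel] at h1
    refine h1.trans (setLIntegral_mono' measurableSet_Icc fun s hs => ?_)
    rw [← latticeSegment_eq, show h (latticeSegment j k l z s) = _ from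
      indicator_of_mem (hk z hz s hs) _]
    refine mul_le_mul_right (pow_le_pow_left' ?_ n) _
    rw [latticeSegment_one_sub_zero, ← ofReal_norm, norm_smul, Real.norm_of_nonneg (by positivity)]
    refine ENNReal.ofReal_le_ofReal ?_
    have : ‖l - z‖ ≤ 3 := (norm_sub_le _ _).trans (by linarith [hb z hz])
    nlinarith
  have hswap : ∀ k : E, ∫⁻ z in D, (∫⁻ s in Icc (0 : ℝ) 1, h (latticeSegment j k l z s) * R) ∂μ
      = ∫⁻ s in Icc (0 : ℝ) 1, (∫⁻ z in D, h (latticeSegment j k l z s) ∂μ) * R := by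
    intro k
    rw [lintegral_lintegral_swap (by fun_prop)]
    exact lintegral_congr fun s => lintegral_mul_const R (by fun_prop)
  -- At fixed s the segment point depends on z through a dilation of ratio (1 - s/2)τ ≥ τ/2. Its
  -- inverse Jacobian cancels the τⁿ in R, leaving 4ⁿ independently of the generation: this is the
  -- scale invariance of the n-energy.
  have hcell : ∀ s ∈ Icc (0 : ℝ) 1,
      ∑' k : span ℤ (range b), (∫⁻ z in D, h (latticeSegment j k l z s) ∂μ) * R ≤
        4 ^ n * ∫⁻ x, h x ∂μ := by
    intro s hs
    rw [ENNReal.tsum_mul_right]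
    have h1 := tsum_lintegral_lattice_cells_le μ b h (θ := 1 - s / 2) (by linarith [hs.2])
      (by linarith [hs.1]) hτ ((s / 2) • l)
    calc _ ≤ ((ENNReal.ofReal ((1 - s / 2) * τ) ^ n)⁻¹ * ∫⁻ x, h x ∂μ) * R := by
          gcongr
          exact h1
      _ ≤ ((ENNReal.ofReal (τ / 2) ^ n)⁻¹ * ∫⁻ x, h x ∂μ) * R := by
          gcongr
          nlinarith [hs.2]
      _ = 4 ^ n * ∫⁻ x, h x ∂μ := by
          have : (ENNReal.ofReal (τ / 2) ^ n)⁻¹ * R = 4 ^ n := by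
            simp only [R]
            rw [ENNReal.inv_pow, ← mul_pow, ← ENNReal.ofReal_inv_of_pos (by positivity),
              ← ENNReal.ofReal_mul (by positivity)]
            have : (τ / 2)⁻¹ * (2 * τ) = 4 := by field_simp; norm_num
            rw [this]
            norm_num
          rw [mul_right_comm, this]
  have : Countable (span ℤ (range b)) := inferInstance
  calc _ ≤ ∑' k : span ℤ (range b),
        ∫⁻ z in D, (∫⁻ s in Icc (0 : ℝ) 1, h (latticeSegment j k l z s) * R) ∂μ :=
        ENNReal.tsum_le_tsum fun k => setLIntegral_mono' hmeas (hstep k)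
    _ = ∫⁻ s in Icc (0 : ℝ) 1,
        ∑' k : span ℤ (range b), (∫⁻ z in D, h (latticeSegment j k l z s) ∂μ) * R := by
        rw [lintegral_tsum]
        · exact tsum_congr fun k => hswap k
        · intro k
          refine Measurable.aemeasurable (Measurable.mul_const ?_ R)
          exact Measurable.lintegral_prod_right (by fun_prop)
    _ ≤ ∫⁻ s in Icc (0 : ℝ) 1, 4 ^ n * ∫⁻ x, h x ∂μ := setLIntegral_mono' measurableSet_Icc hcell
    _ = _ := by
        rw [setLIntegral_const, Real.volume_Icc]
        simp only [h, lintegral_indicator hS]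
        simp

end Segments

/-! ### Summability of the increments over all generations -/

section Increments

open Module Submodule Filter Topology

variable {E : Type*} [NormedAddCommGroup E] [NormedSpace ℝ E]
  [FiniteDimensional ℝ E] [MeasurableSpace E] [BorelSpace E] (μ : Measure E)
  [μ.IsAddHaarMeasure] {ι : Type*} [Finite ι] (b : Basis ι ℝ E)
  {V : Type*} [NormedAddCommGroup V] [NormedSpace ℝ V]

/-- The `n`-th power of the increment of `u` along a lattice segment, or zero if the segments with
the same lattice data leave `S`. -/
noncomputable def segmentIncrement (u : E → V) (S : Set E) (j : ℕ) (k l z : E) : ℝ≥0∞ :=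
  {_z | SegmentsSubset b S j k l}.indicator (fun z =>
    ‖u (latticeSegment j k l z 1) - u (latticeSegment j k l z 0)‖ₑ ^ finrank ℝ E) z

omit [FiniteDimensional ℝ E] [MeasurableSpace E] [BorelSpace E] [Finite ι] [NormedSpace ℝ V] in
lemma segmentIncrement_of_subset {u : E → V} {S : Set E} {j : ℕ} {k l : E}
    (h : SegmentsSubset b S j k l) (z : E) :
    segmentIncrement b u S j k l z =
      ‖u (latticeSegment j k l z 1) - u (latticeSegment j k l z 0)‖ₑ ^ finrank ℝ E :=
  indicator_of_mem (s := {_z | SegmentsSubset b S j k l}) h _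

omit [FiniteDimensional ℝ E] [MeasurableSpace E] [BorelSpace E] [Finite ι] [NormedSpace ℝ V] in
lemma segmentIncrement_of_not_subset {u : E → V} {S : Set E} {j : ℕ} {k l : E}
    (h : ¬ SegmentsSubset b S j k l) (z : E) : segmentIncrement b u S j k l z = 0 :=
  indicator_of_notMem (s := {_z | SegmentsSubset b S j k l}) h _

-- The containment condition concerns the whole cell and not the individual z, so it causes no
-- measurability problem.
omit [Finite ι] [NormedSpace ℝ V] in
lemma measurable_segmentIncrement [MeasurableSpace V] [BorelSpace V] [SecondCountableTopology V]
    {u : E → V} (hu : Measurable u) (S : Set E) (j : ℕ) (k l : E) :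
    Measurable (segmentIncrement b u S j k l) := by
  by_cases h : SegmentsSubset b S j k l
  · simp only [funext (segmentIncrement_of_subset b (u := u) h)]
    fun_prop
  · simp only [funext (segmentIncrement_of_not_subset b (u := u) h)]
    fun_prop

/-- The bounds for single generations add up because the annuli have bounded overlap. The set B
localises the energy, since mollifications are controlled only on smaller balls. -/
lemma tsum_lintegral_segmentIncrement_le_of_contDiff [CompleteSpace V] (hn : 1 ≤ finrank ℝ E)
    (hb : ∀ z ∈ ZSpan.fundamentalDomain b, ‖z‖ ≤ 1) {u : E → V} (hu : ContDiff ℝ 1 u) {B : Set E}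
    (hB : MeasurableSet B) {l : E} (hl : ‖l‖ ≤ 2) :
    ∑' p : ℕ × span ℤ (range b), ∫⁻ z in ZSpan.fundamentalDomain b,
      segmentIncrement b u (dyadicAnnulus E p.1 ∩ B) p.1 p.2 l z ∂μ ≤
      3 * 4 ^ finrank ℝ E * ∫⁻ x in B, ‖fderiv ℝ u x‖ₑ ^ finrank ℝ E ∂μ := by
  set n := finrank ℝ E
  have hA : ∀ j, MeasurableSet (dyadicAnnulus E j) := fun j => (isOpen_dyadicAnnulus j).measurableSet
  rw [ENNReal.tsum_prod']
  calc _ ≤ ∑' j, 4 ^ n * ∫⁻ x in dyadicAnnulus E j,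
        B.indicator (fun x => ‖fderiv ℝ u x‖ₑ ^ n) x ∂μ := by
        refine ENNReal.tsum_le_tsum fun j => ?_
        rw [setLIntegral_indicator hB, inter_comm B]
        exact tsum_lintegral_enorm_sub_le_of_generation μ b hn hb hu ((hA j).inter hB) j hl
    _ ≤ 4 ^ n * (3 * ∫⁻ x, B.indicator (fun x => ‖fderiv ℝ u x‖ₑ ^ n) x ∂μ) := by
        rw [ENNReal.tsum_mul_left]
        gcongr
        exact tsum_lintegral_dyadicAnnulus_le μ _
    _ = _ := by rw [lintegral_indicator hB]; ring

/-- Passing to the limit from smooth approximations with uniformly bounded energy, the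
increments of `f` over all the lattice segments near the unit sphere are summable on average. -/
lemma lintegral_tsum_segmentIncrement_le [CompleteSpace V] [MeasurableSpace V] [BorelSpace V]
    [SecondCountableTopology V] (hn : 1 ≤ finrank ℝ E)
    (hb : ∀ z ∈ ZSpan.fundamentalDomain b, ‖z‖ ≤ 1) {f : E → V} (hf : Measurable f) {K : ℝ≥0∞}
    (happrox : ∀ R < (1 : ℝ), ∃ u : ℕ → E → V, (∀ i, ContDiff ℝ 1 (u i)) ∧
      (∀ i, ∫⁻ x in ball 0 R, ‖fderiv ℝ (u i) x‖ₑ ^ finrank ℝ E ∂μ ≤ K) ∧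
      ∀ x ∈ ball (0 : E) R, Tendsto (fun i => u i x) atTop (𝓝 (f x)))
    {l : E} (hl : ‖l‖ ≤ 2) :
    ∫⁻ z in ZSpan.fundamentalDomain b, ∑' p : ℕ × span ℤ (range b),
      segmentIncrement b f (dyadicAnnulus E p.1) p.1 p.2 l z ∂μ ≤
      3 * 4 ^ finrank ℝ E * K := by
  have hcount : Countable (span ℤ (range b)) := inferInstance
  rw [lintegral_tsum fun p => (measurable_segmentIncrement b hf _ _ _ _).aemeasurable,
    ENNReal.tsum_eq_iSup_sum]
  refine iSup_le fun s => ?_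
  -- A finite partial sum involves finitely many generations, whose annuli all lie in this smaller
  -- ball; there the approximations are available and Fatou's lemma applies.
  set R : ℝ := 1 - (1 / 4) * (1 / 2) ^ (s.sup Prod.fst)
  have hR : R < 1 := sub_lt_self _ (by positivity)
  obtain ⟨u, hu, hK, hlim⟩ := happrox R hR
  have humeas : ∀ i, Measurable (u i) := fun i => (hu i).continuous.measurable
  have hsub : ∀ p ∈ s, SegmentsSubset b (dyadicAnnulus E p.1) p.1 p.2 l →
      SegmentsSubset b (dyadicAnnulus E p.1 ∩ ball 0 R) p.1 p.2 l := by
    intro p hp h z hz t ht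
    refine ⟨h z hz t ht, ?_⟩
    have h1 := (h z hz t ht).1
    have h2 : (1 / 2 : ℝ) ^ s.sup Prod.fst ≤ (1 / 2) ^ p.1 :=
      pow_le_pow_of_le_one (by norm_num) (by norm_num) (Finset.le_sup (f := Prod.fst) hp)
    rw [mem_ball_zero_iff]
    simp only [R]
    linarith
  rw [← lintegral_finsetSum _ fun p _ => measurable_segmentIncrement b hf _ _ _ _]
  calc _ ≤ ∫⁻ z in ZSpan.fundamentalDomain b, liminf (fun i => ∑ p ∈ s,
        segmentIncrement b (u i) (dyadicAnnulus E p.1 ∩ ball 0 R) p.1 p.2 l z) atTop ∂μ := by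
        refine setLIntegral_mono' (ZSpan.fundamentalDomain_measurableSet b) fun z hz => ?_
        refine le_of_eq (Tendsto.liminf_eq ?_).symm
        refine tendsto_finsetSum _ fun p hp => ?_
        by_cases h : SegmentsSubset b (dyadicAnnulus E p.1) p.1 p.2 l
        · have h' := hsub p hp h
          simp only [segmentIncrement_of_subset b h, segmentIncrement_of_subset b h']
          exact ((ENNReal.continuous_pow _).tendsto _).comp
            ((hlim _ (h' z hz 1 (by simp)).2).sub (hlim _ (h' z hz 0 (by simp)).2)).enorm
        · have h' : ¬ SegmentsSubset b (dyadicAnnulus E p.1 ∩ ball 0 R) p.1 p.2 l :=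
            fun h' => h fun z hz t ht => (h' z hz t ht).1
          simp only [segmentIncrement_of_not_subset b h, segmentIncrement_of_not_subset b h']
          exact tendsto_const_nhds
    _ ≤ liminf (fun i => ∫⁻ z in ZSpan.fundamentalDomain b, ∑ p ∈ s,
        segmentIncrement b (u i) (dyadicAnnulus E p.1 ∩ ball 0 R) p.1 p.2 l z ∂μ) atTop :=
        lintegral_liminf_le fun i => Finset.measurable_sum _ fun p _ =>
          measurable_segmentIncrement b (humeas i) _ _ _ _
    _ ≤ _ := by
        refine liminf_le_of_frequently_le' (Frequently.of_forall fun i => ?_)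
        rw [lintegral_finsetSum _ fun p _ => measurable_segmentIncrement b (humeas i) _ _ _ _]
        refine (ENNReal.sum_le_tsum s).trans ((tsum_lintegral_segmentIncrement_le_of_contDiff μ b hn
          hb (hu i) measurableSet_ball hl).trans ?_)
        gcongr
        exact hK i

end Increments

/-! ### Mollification of Sobolev maps -/

section Mollification

open Filter Topology

/-- Convolution with a probability density does not increase the `n`-th moment. -/
lemma lintegral_pow_lintegral_mul_le {E : Type*} [NormedAddCommGroup E] [MeasurableSpace E]
    [BorelSpace E] [SecondCountableTopology E] (μ : Measure E) [SigmaFinite μ]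
    [μ.IsAddLeftInvariant] [μ.IsNegInvariant] {n : ℕ} (hn : 1 ≤ n) {φ G : E → ℝ≥0∞}
    (hφ : Measurable φ) (hφ1 : ∫⁻ x, φ x ∂μ = 1) (hG : Measurable G) :
    ∫⁻ x, (∫⁻ y, φ (x - y) * G y ∂μ) ^ n ∂μ ≤ ∫⁻ y, G y ^ n ∂μ := by
  have hright : μ.IsAddRightInvariant := inferInstance
  have hjensen : ∀ x, (∫⁻ y, φ (x - y) * G y ∂μ) ^ n ≤ ∫⁻ y, φ (x - y) * G y ^ n ∂μ := by
    intro x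
    have hm : Measurable fun y => φ (x - y) := by fun_prop
    have hprob : IsProbabilityMeasure (μ.withDensity fun y => φ (x - y)) := ⟨by
      rw [withDensity_apply _ MeasurableSet.univ, Measure.restrict_univ,
        lintegral_sub_left_eq_self, hφ1]⟩
    have h1 := lintegral_pow_le_of_isProbabilityMeasure (μ.withDensity fun y => φ (x - y)) hn
      hG.aemeasurable
    rwa [lintegral_withDensity_eq_lintegral_mul₀ hm.aemeasurable hG.aemeasurable,
      lintegral_withDensity_eq_lintegral_mul₀ hm.aemeasurable
        (hG.pow_const n).aemeasurable] at h1
  calc _ ≤ ∫⁻ x, ∫⁻ y, φ (x - y) * G y ^ n ∂μ ∂μ := lintegral_mono hjensen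
    _ = ∫⁻ y, ∫⁻ x, φ (x - y) * G y ^ n ∂μ ∂μ := lintegral_lintegral_swap (by fun_prop)
    _ = ∫⁻ y, G y ^ n ∂μ := by
        refine lintegral_congr fun y => ?_
        rw [lintegral_mul_const _ (by fun_prop), lintegral_sub_right_eq_self, hφ1, one_mul]

variable {n m : ℕ} {Ω : Set (EuclideanSpace ℝ (Fin n))}

lemma EuclideanSpace.enorm_clm_le_sum {V : Type*} [NormedAddCommGroup V] [NormedSpace ℝ V]
    (T : EuclideanSpace ℝ (Fin n) →L[ℝ] V) :
    ‖T‖ₑ ≤ ∑ i, ‖T (EuclideanSpace.single i 1)‖ₑ := by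
  have h : ‖T‖ ≤ ∑ i, ‖T (EuclideanSpace.single i 1)‖ := by
    refine T.opNorm_le_bound (by positivity) fun v => ?_
    have hv : v = ∑ i, v i • EuclideanSpace.single i (1 : ℝ) := by
      conv_lhs => rw [← (EuclideanSpace.basisFun (Fin n) ℝ).sum_repr v]
      simp
    conv_lhs => rw [hv, map_sum]
    rw [Finset.sum_mul]
    refine (norm_sum_le _ _).trans (Finset.sum_le_sum fun i _ => ?_)
    rw [map_smul, norm_smul, mul_comm]
    gcongr
    exact PiLp.norm_apply_le v i
  simp only [← ofReal_norm]
  rw [← ENNReal.ofReal_sum_of_nonneg fun i _ => norm_nonneg _]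
  exact ENNReal.ofReal_le_ofReal h

/-- The derivative of a mollification of `f` is the mollification of the weak derivative, away
from the boundary of `Ω`. -/
lemma HasWeakPartialDeriv.fderiv_convolution {i : Fin n}
    {f g : EuclideanSpace ℝ (Fin n) → EuclideanSpace ℝ (Fin m)} (hΩ : MeasurableSet Ω)
    (h : HasWeakPartialDeriv Ω i f g) (hf : LocallyIntegrable (Ω.indicator f))
    {φ : EuclideanSpace ℝ (Fin n) → ℝ} (hφ : ContDiff ℝ ∞ φ) (hφc : HasCompactSupport φ)
    {x : EuclideanSpace ℝ (Fin n)} (hx : ∀ y, x - y ∈ tsupport φ → y ∈ Ω) :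
    fderiv ℝ (convolution φ (Ω.indicator f) (ContinuousLinearMap.lsmul ℝ ℝ) volume) x
      (EuclideanSpace.single i 1) = ∫ y, φ (x - y) • Ω.indicator g y := by
  have hφ1 : ContDiff ℝ 1 φ := hφ.of_le (by exact_mod_cast le_top)
  have hdφ : Continuous (fderiv ℝ φ) := hφ1.continuous_fderiv one_ne_zero
  rw [(hφc.hasFDerivAt_convolution_left (ContinuousLinearMap.lsmul ℝ ℝ) hφ1 hf x).fderiv,
    convolution_eq_swap]
  have hint := ((hφc.fderiv ℝ).convolutionExists_left
    ((ContinuousLinearMap.lsmul ℝ ℝ).precompL (EuclideanSpace ℝ (Fin n))) hdφ hf x).integrable_swap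
  rw [ContinuousLinearMap.integral_apply hint]
  -- The weak derivative is tested against y ↦ φ (x - y); the sign from the inner derivative cancels
  -- the one from integration by parts.
  have hψ : ContDiff ℝ ∞ (fun y => φ (x - y)) := by fun_prop
  have hψc : HasCompactSupport (fun y => φ (x - y)) :=
    hφc.comp_homeomorph (Homeomorph.subLeft x)
  have hψs : tsupport (fun y => φ (x - y)) ⊆ Ω := fun y hy =>
    hx y (tsupport_comp_subset_preimage φ (f := fun y => x - y) (by fun_prop) hy)
  have hder : ∀ y, fderiv ℝ (fun y => φ (x - y)) y (EuclideanSpace.single i 1) =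
      - fderiv ℝ φ (x - y) (EuclideanSpace.single i 1) := by
    intro y
    have h1 : HasFDerivAt (fun y => x - y) (-(ContinuousLinearMap.id ℝ _)) y :=
      (hasFDerivAt_id y).const_sub x
    have h2 : HasFDerivAt (fun y => φ (x - y)) _ y :=
      (hφ1.differentiable one_ne_zero (x - y)).hasFDerivAt.comp y h1
    rw [h2.fderiv]
    simp
  have key := h.integral_eq _ hψ hψc hψs
  simp only [hder, neg_smul, integral_neg, neg_inj] at key
  simp only [ContinuousLinearMap.precompL_apply, ContinuousLinearMap.lsmul_apply]
  rw [← integral_indicator hΩ, ← integral_indicator hΩ] at key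
  simp only [indicator_smul] at key
  exact key

/-- A continuous Sobolev function on the unit ball is locally a pointwise limit of smooth functions
with uniformly bounded `n`-energy. -/
lemma MemSobolevOne.exists_contDiff_approx (hn : 1 ≤ n)
    {f : EuclideanSpace ℝ (Fin n) → EuclideanSpace ℝ (Fin m)}
    (hf : MemSobolevOne (n : ℝ≥0∞) (ball 0 1) f) (hcont : ContinuousOn f (ball 0 1)) :
    ∃ K : ℝ≥0∞, K ≠ ⊤ ∧ ∀ R < (1 : ℝ),
      ∃ u : ℕ → EuclideanSpace ℝ (Fin n) → EuclideanSpace ℝ (Fin m),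
        (∀ i, ContDiff ℝ 1 (u i)) ∧ (∀ i, ∫⁻ x in ball 0 R, ‖fderiv ℝ (u i) x‖ₑ ^ n ≤ K) ∧
        ∀ x ∈ ball (0 : EuclideanSpace ℝ (Fin n)) R,
          Tendsto (fun i => u i x) atTop (𝓝 ((ball 0 1).indicator f x)) := by
  obtain ⟨hfn, hg⟩ := hf
  choose g hgn hg using hg
  set B := ball (0 : EuclideanSpace ℝ (Fin n)) 1
  have hB : MeasurableSet B := measurableSet_ball
  have hn' : (1 : ℝ≥0∞) ≤ n := by exact_mod_cast hn
  have hBfin : IsFiniteMeasure (volume.restrict B) := ⟨by simp [B, measure_ball_lt_top]⟩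
  have hfint : LocallyIntegrable (B.indicator f) :=
    ((integrable_indicator_iff hB).2 (hfn.integrable hn')).locallyIntegrable
  have hGmem : MemLp (fun y => ∑ i, ‖B.indicator (g i) y‖) n volume :=
    memLp_finsetSum _ fun i _ => ((memLp_indicator_iff_restrict hB).2 (hgn i)).norm
  obtain ⟨G, hGm, hG⟩ : ∃ G : EuclideanSpace ℝ (Fin n) → ℝ≥0∞, Measurable G ∧
      (fun y => ∑ i, ‖B.indicator (g i) y‖ₑ) =ᵐ[volume] G := by
    have h : AEMeasurable (fun y => ∑ i, ‖B.indicator (g i) y‖ₑ) volume :=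
      Finset.aemeasurable_fun_sum _ fun i _ =>
        ((memLp_indicator_iff_restrict hB).2 (hgn i)).aestronglyMeasurable.enorm
    exact ⟨h.mk _, h.measurable_mk, h.ae_eq_mk⟩
  refine ⟨∫⁻ y, G y ^ n, ?_, fun R hR => ?_⟩
  · have h1 := lintegral_rpow_enorm_lt_top_of_eLpNorm_lt_top (by positivity)
      (ENNReal.natCast_ne_top n) hGmem.2
    refine ne_of_lt (lt_of_le_of_lt (le_of_eq (lintegral_congr_ae ?_)) h1)
    filter_upwards [hG] with y hy
    rw [← hy, ENNReal.toReal_natCast, ENNReal.rpow_natCast]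
    congr 1
    rw [Real.enorm_of_nonneg (by positivity), ENNReal.ofReal_sum_of_nonneg fun i _ => norm_nonneg _]
    simp only [ofReal_norm]
  have hε : ∀ i : ℕ, 0 < (1 - R) / (i + 1) := fun i => div_pos (by linarith) (by positivity)
  -- The outer radius is below 1 - R, so on the ball of radius R the mollification sees only points
  -- of the unit ball.
  let φ : ℕ → ContDiffBump (0 : EuclideanSpace ℝ (Fin n)) := fun i =>
    ⟨(1 - R) / (i + 1) / 4, (1 - R) / (i + 1) / 2, by linarith [hε i], by linarith [hε i]⟩
  have hout : ∀ i, (φ i).rOut = (1 - R) / (i + 1) / 2 := fun i => rfl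
  refine ⟨fun i => convolution ((φ i).normed volume) (B.indicator f)
    (ContinuousLinearMap.lsmul ℝ ℝ) volume, fun i => ?_, fun i => ?_, fun x hx => ?_⟩
  · exact (φ i).hasCompactSupport_normed.contDiff_convolution_left (n := 1) _
      (φ i).contDiff_normed hfint
  · have hball : ∀ x ∈ ball (0 : EuclideanSpace ℝ (Fin n)) R, ∀ y,
        x - y ∈ tsupport ((φ i).normed volume) → y ∈ B := by
      intro x hx y hy
      rw [(φ i).tsupport_normed_eq, mem_closedBall_zero_iff, hout] at hy
      rw [mem_ball_zero_iff] at hx ⊢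
      have h1 : ‖y‖ ≤ ‖x‖ + ‖x - y‖ := by
        have := norm_sub_le x (x - y)
        rwa [sub_sub_cancel] at this
      have h2 : (1 - R) / (i + 1) ≤ 1 - R :=
        div_le_self (by linarith) (by linarith [show (0 : ℝ) ≤ i from Nat.cast_nonneg i])
      linarith
    have hφm : Measurable fun x => ENNReal.ofReal ((φ i).normed volume x) :=
      ((φ i).contDiff_normed (n := 0)).continuous.measurable.ennreal_ofReal
    have hφ1 : ∫⁻ x, ENNReal.ofReal ((φ i).normed volume x) = 1 := by
      rw [← ofReal_integral_eq_lintegral_ofReal (φ i).integrable_normed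
        (ae_of_all _ (φ i).nonneg_normed), (φ i).integral_normed, ENNReal.ofReal_one]
    refine le_trans ?_ (lintegral_pow_lintegral_mul_le volume hn hφm hφ1 hGm)
    refine (setLIntegral_mono' measurableSet_ball fun x hx => ?_).trans
      (setLIntegral_le_lintegral _ _)
    refine pow_le_pow_left' ?_ n
    calc _ ≤ ∑ j, ‖∫ y, (φ i).normed volume (x - y) • B.indicator (g j) y‖ₑ := by
          refine (EuclideanSpace.enorm_clm_le_sum _).trans (Finset.sum_le_sum fun j _ => ?_)
          rw [(hg j).fderiv_convolution hB hfint (φ i).contDiff_normed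
            (φ i).hasCompactSupport_normed (hball x hx)]
      _ ≤ ∑ j, ∫⁻ y, ENNReal.ofReal ((φ i).normed volume (x - y)) * ‖B.indicator (g j) y‖ₑ := by
          refine Finset.sum_le_sum fun j _ => (enorm_integral_le_lintegral_enorm _).trans_eq ?_
          refine lintegral_congr fun y => ?_
          rw [enorm_smul, Real.enorm_of_nonneg ((φ i).nonneg_normed _)]
      _ = ∫⁻ y, ENNReal.ofReal ((φ i).normed volume (x - y)) *
            ∑ j, ‖B.indicator (g j) y‖ₑ := by
          simp only [Finset.mul_sum]
          refine (lintegral_finsetSum' _ fun j _ => ?_).symm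
          exact AEMeasurable.mul (hφm.comp (measurable_const.sub measurable_id)).aemeasurable
            ((memLp_indicator_iff_restrict hB).2 (hgn j)).aestronglyMeasurable.enorm
      _ = _ := by
          refine lintegral_congr_ae ?_
          filter_upwards [hG] with y hy
          rw [← hy]
  · have hxB : x ∈ B := ball_subset_ball hR.le hx
    have hc : ContinuousAt (B.indicator f) x :=
      (hcont.continuousAt (isOpen_ball.mem_nhds hxB)).congr
        (eventuallyEq_of_mem (isOpen_ball.mem_nhds hxB) eqOn_indicator.symm)
    refine ContDiffBump.convolution_tendsto_right (g := fun _ => B.indicator f) ?_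
      (Eventually.of_forall fun _ => hfint.aestronglyMeasurable)
      (hc.tendsto.comp tendsto_snd) tendsto_const_nhds
    simp only [hout]
    have := (tendsto_one_div_add_atTop_nhds_zero_nat (𝕜 := ℝ)).const_mul ((1 - R) / 2)
    rw [mul_zero] at this
    exact this.congr fun i => by field_simp

end Mollification

/-! ### Chains of lattice points along radii -/

section RadialChains

open Module Submodule Filter Topology

lemma EuclideanSpace.exists_basis_sum_norm_le (n : ℕ) {ε : ℝ} (hε : 0 < ε) :
    ∃ b : Basis (Fin n) ℝ (EuclideanSpace ℝ (Fin n)), ∑ i, ‖b i‖ ≤ ε := by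
  have hw : ∀ _ : Fin n, IsUnit (ε / (n + 1)) := fun _ =>
    (div_pos hε (by positivity)).ne'.isUnit
  refine ⟨(EuclideanSpace.basisFun (Fin n) ℝ).toBasis.isUnitSMul hw, ?_⟩
  simp only [Basis.isUnitSMul_apply, norm_smul, OrthonormalBasis.coe_toBasis,
    OrthonormalBasis.norm_eq_one, mul_one, Finset.sum_const, Finset.card_univ, Fintype.card_fin,
    nsmul_eq_mul]
  rw [Real.norm_of_nonneg (by positivity), mul_div_assoc', div_le_iff₀ (by positivity)]
  nlinarith

variable {E : Type*} [NormedAddCommGroup E] [NormedSpace ℝ E] {ι : Type*} [Fintype ι]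
  (b : Basis ι ℝ E)

lemma ZSpan.norm_le_of_mem_fundamentalDomain {z : E} (hz : z ∈ ZSpan.fundamentalDomain b) :
    ‖z‖ ≤ ∑ i, ‖b i‖ := by
  rw [← (ZSpan.fract_eq_self (b := b)).2 hz]
  exact ZSpan.norm_fract_le b z

/-- The lattice cell of generation `j` met by the ray through `ξ` at distance `2⁻ʲ` from the
unit sphere. -/
noncomputable def rayCell (ξ : E) (j : ℕ) : span ℤ (range b) :=
  ZSpan.floor b (((2 : ℝ) ^ j - 1) • ξ)

/-- The displacement from a ray cell to the next one. -/
noncomputable def rayStep (ξ : E) (j : ℕ) : E :=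
  rayCell b ξ (j + 1) - (2 : ℝ) • (rayCell b ξ j : E)

/-- With `norm_rayStep_le` this confines all ray steps, for every ξ and j, to one finite set of
lattice vectors. -/
lemma rayStep_mem (ξ : E) (j : ℕ) : rayStep b ξ j ∈ span ℤ (range b) := by
  have : rayStep b ξ j = ((rayCell b ξ (j + 1) - (2 : ℤ) • rayCell b ξ j :
      span ℤ (range b)) : E) := by
    push_cast
    rw [rayStep, ← Int.cast_smul_eq_zsmul ℝ]
    norm_num
  rw [this]
  exact SetLike.coe_mem _

lemma rayCell_zero (ξ : E) : (rayCell b ξ 0 : E) = 0 := by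
  simp only [rayCell, pow_zero, sub_self, zero_smul]
  exact ZSpan.floor_eq_self_of_mem b 0 (zero_mem _)

lemma rayCell_eq (ξ : E) (j : ℕ) : (rayCell b ξ j : E) =
    ((2 : ℝ) ^ j - 1) • ξ - ZSpan.fract b (((2 : ℝ) ^ j - 1) • ξ) := by
  rw [ZSpan.fract_apply, rayCell, sub_sub_cancel]

lemma latticeSegment_ray_one (ξ z : E) (j : ℕ) :
    latticeSegment j (rayCell b ξ j : E) (rayStep b ξ j) z 1 =
      (1 / 2 : ℝ) ^ (j + 1) • ((rayCell b ξ (j + 1) : E) + z) := by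
  simp only [latticeSegment, rayStep, pow_succ]
  module

lemma latticeSegment_ray_zero (ξ z : E) (j : ℕ) :
    latticeSegment j (rayCell b ξ j : E) (rayStep b ξ j) z 0 =
      (1 / 2 : ℝ) ^ j • ((rayCell b ξ j : E) + z) := by
  simp [latticeSegment]

lemma smul_rayCell_add_eq (ξ z : E) (j : ℕ) :
    (1 / 2 : ℝ) ^ j • ((rayCell b ξ j : E) + z) = (1 - (1 / 2 : ℝ) ^ j) • ξ +
      (1 / 2 : ℝ) ^ j • (z - ZSpan.fract b (((2 : ℝ) ^ j - 1) • ξ)) := by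
  rw [rayCell_eq]
  have : (1 / 2 : ℝ) ^ j * (2 ^ j - 1) = 1 - (1 / 2) ^ j := by
    rw [mul_sub, ← mul_pow]
    norm_num
  rw [← this]
  module

variable {b} (hb : ∑ i, ‖b i‖ ≤ 1 / 16)
include hb

/-- Since (2^(j+1) - 1) - 2(2^j - 1) = 1, the step is ξ up to fractional parts of size at most 1/16.
-/
lemma norm_rayStep_le {ξ : E} (hξ : ‖ξ‖ = 1) (j : ℕ) : ‖rayStep b ξ j‖ ≤ 2 := by
  have h : rayStep b ξ j = ξ - ZSpan.fract b (((2 : ℝ) ^ (j + 1) - 1) • ξ) +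
      (2 : ℝ) • ZSpan.fract b (((2 : ℝ) ^ j - 1) • ξ) := by
    rw [rayStep, rayCell_eq, rayCell_eq, pow_succ]
    module
  rw [h]
  refine (norm_add_le _ _).trans ?_
  rw [norm_smul, Real.norm_two]
  have h1 := (ZSpan.norm_fract_le b (((2 : ℝ) ^ (j + 1) - 1) • ξ)).trans hb
  have h2 := (ZSpan.norm_fract_le b (((2 : ℝ) ^ j - 1) • ξ)).trans hb
  have h3 := norm_sub_le ξ (ZSpan.fract b (((2 : ℝ) ^ (j + 1) - 1) • ξ))
  linarith

lemma norm_sub_fract_le {z : E} (hz : z ∈ ZSpan.fundamentalDomain b) (y : E) :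
    ‖z - ZSpan.fract b y‖ ≤ 1 / 8 := by
  have h1 := (ZSpan.norm_fract_le b y).trans hb
  have h2 := (ZSpan.norm_le_of_mem_fundamentalDomain b hz).trans hb
  linarith [norm_sub_le z (ZSpan.fract b y)]

/-- With τ = 2⁻ʲ, the segment follows points of the radius at distance between τ/2 and τ from the
sphere, with error at most τ/8. Its distance to the sphere thus lies between 3τ/8 and 9τ/8, inside
the range of the annulus. -/
lemma segmentsSubset_ray {ξ : E} (hξ : ‖ξ‖ = 1) (j : ℕ) :
    SegmentsSubset b (dyadicAnnulus E j) j (rayCell b ξ j) (rayStep b ξ j) := by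
  rintro z hz s ⟨hs0, hs1⟩
  set τ : ℝ := (1 / 2) ^ j with hτ
  have hτ0 : 0 < τ := by positivity
  have hτ1 : τ ≤ 1 := pow_le_one₀ (by norm_num) (by norm_num)
  have h1 := norm_sub_fract_le hb hz (((2 : ℝ) ^ j - 1) • ξ)
  have h2 := norm_sub_fract_le hb hz (((2 : ℝ) ^ (j + 1) - 1) • ξ)
  set r₀ := z - ZSpan.fract b (((2 : ℝ) ^ j - 1) • ξ)
  set r₁ := z - ZSpan.fract b (((2 : ℝ) ^ (j + 1) - 1) • ξ)
  set r := ((1 - s) * τ) • r₀ + (s * (τ / 2)) • r₁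
  have hx : latticeSegment j (rayCell b ξ j : E) (rayStep b ξ j) z s =
      (1 - τ + s * (τ / 2)) • ξ + r := by
    rw [latticeSegment_eq, latticeSegment_ray_one, latticeSegment_ray_zero, smul_rayCell_add_eq,
      smul_rayCell_add_eq, pow_succ, ← hτ]
    module
  have hr : ‖r‖ ≤ τ / 8 := by
    refine (norm_add_le _ _).trans ?_
    rw [norm_smul, norm_smul, Real.norm_of_nonneg (by nlinarith),
      Real.norm_of_nonneg (by positivity)]
    have h3 : (1 - s) * τ * ‖r₀‖ ≤ (1 - s) * τ * (1 / 8) :=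
      mul_le_mul_of_nonneg_left h1 (by nlinarith)
    have h4 : s * (τ / 2) * ‖r₁‖ ≤ s * (τ / 2) * (1 / 8) :=
      mul_le_mul_of_nonneg_left h2 (by positivity)
    nlinarith
  have hc : 0 ≤ 1 - τ + s * (τ / 2) := by nlinarith
  have hn : ‖(1 - τ + s * (τ / 2)) • ξ‖ = 1 - τ + s * (τ / 2) := by
    rw [norm_smul, hξ, mul_one, Real.norm_of_nonneg hc]
  have h5 := norm_add_le ((1 - τ + s * (τ / 2)) • ξ) r
  have h6 := norm_sub_le ((1 - τ + s * (τ / 2)) • ξ + r) r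
  rw [add_sub_cancel_right] at h6
  rw [hn] at h5 h6
  rw [hx]
  exact ⟨by nlinarith, by nlinarith⟩

lemma tendsto_smul_rayCell_add (ξ : E) {z : E} (hz : z ∈ ZSpan.fundamentalDomain b) :
    Tendsto (fun j : ℕ => (1 / 2 : ℝ) ^ j • ((rayCell b ξ j : E) + z)) atTop (𝓝 ξ) := by
  have hpow : Tendsto (fun j : ℕ => (1 / 2 : ℝ) ^ j) atTop (𝓝 0) :=
    tendsto_pow_atTop_nhds_zero_of_lt_one (by norm_num) (by norm_num)
  simp only [smul_rayCell_add_eq]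
  have h1 : Tendsto (fun j : ℕ => (1 - (1 / 2 : ℝ) ^ j) • ξ) atTop (𝓝 ξ) := by
    simpa using (hpow.const_sub 1).smul_const ξ
  have h2 : Tendsto (fun j : ℕ => (1 / 2 : ℝ) ^ j •
      (z - ZSpan.fract b (((2 : ℝ) ^ j - 1) • ξ))) atTop (𝓝 0) :=
    hpow.zero_smul_isBoundedUnder_le
      (isBoundedUnder_of ⟨1 / 8, fun j => norm_sub_fract_le hb hz _⟩)
  simpa using h1.add h2

end RadialChains

/-! ### Extension of Hölder maps to the closure -/

section Holder

open Filter Topology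

lemma uniformContinuousOn_of_norm_sub_le_rpow {E V : Type*} [SeminormedAddCommGroup E]
    [SeminormedAddCommGroup V] {f : E → V} {s : Set E} {C γ : ℝ} (hC : 0 < C) (hγ : 0 < γ)
    (h : ∀ z ∈ s, ∀ w ∈ s, ‖f z - f w‖ ≤ C * ‖z - w‖ ^ γ) : UniformContinuousOn f s := by
  refine Metric.uniformContinuousOn_iff.2 fun ε hε => ⟨(ε / C) ^ (1 / γ), by positivity, ?_⟩
  intro x hx y hy hxy
  rw [dist_eq_norm] at hxy ⊢
  calc _ ≤ C * ‖x - y‖ ^ γ := h x hx y hy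
    _ < C * ((ε / C) ^ (1 / γ)) ^ γ := by gcongr
    _ = ε := by
      rw [← Real.rpow_mul (by positivity), one_div_mul_cancel hγ.ne', Real.rpow_one]
      field_simp

lemma UniformContinuousOn.exists_tendsto_nhdsWithin {X Y : Type*} [UniformSpace X] [UniformSpace Y]
    [CompleteSpace Y] {f : X → Y} {s : Set X} (hf : UniformContinuousOn f s) {x : X}
    (hx : x ∈ closure s) : ∃ y, Tendsto f (𝓝[s] x) (𝓝 y) := by
  have : (𝓝[s] x).NeBot := mem_closure_iff_nhdsWithin_neBot.1 hx
  exact cauchy_map_iff_exists_tendsto.1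
    ((cauchy_nhds.mono' this inf_le_left).map_of_le hf inf_le_right)

end Holder

/-! ### Choice of the base point and conclusion -/

section Assembly

open Module Submodule Filter Topology

/-- The increments of a Hölder map along the lattice segments decay geometrically. -/
lemma norm_sub_latticeSegment_le_of_holder {E V : Type*} [NormedAddCommGroup E] [NormedSpace ℝ E]
    [SeminormedAddCommGroup V] {f : E → V} {C γ : ℝ} (hC : 0 < C) (hγ : 0 < γ)
    (h : ∀ z ∈ ball (0 : E) 1, ∀ w ∈ ball (0 : E) 1, ‖f z - f w‖ ≤ C * ‖z - w‖ ^ γ)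
    {j : ℕ} {k l z : E} (hl : ‖l‖ ≤ 2) (hz : ‖z‖ ≤ 1)
    (h₀ : latticeSegment j k l z 0 ∈ ball 0 1) (h₁ : latticeSegment j k l z 1 ∈ ball 0 1) :
    ‖f (latticeSegment j k l z 1) - f (latticeSegment j k l z 0)‖ ≤
      C * 4 ^ γ * ((((1 / 2 : ℝ) ^ (γ / 2)) ^ (j + 1)) * (((1 / 2 : ℝ) ^ (γ / 2)) ^ (j + 1))) := by
  -- The decay 2^(-γ) per level is split into two equal factors: the covering criterion spends one
  -- on its threshold and the other on the logarithm.
  have hw : (((1 / 2 : ℝ) ^ (γ / 2)) ^ (j + 1)) * (((1 / 2 : ℝ) ^ (γ / 2)) ^ (j + 1)) =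
      ((1 / 2 : ℝ) ^ (j + 1)) ^ γ := by
    rw [← mul_pow, ← Real.rpow_add (by norm_num), add_halves, Real.rpow_pow_comm (by norm_num)]
  rw [hw, mul_assoc, ← Real.mul_rpow (by norm_num) (by positivity)]
  refine (h _ h₁ _ h₀).trans ?_
  gcongr
  rw [latticeSegment_one_sub_zero, norm_smul, Real.norm_of_nonneg (by positivity), ← pow_succ]
  have h3 : ‖l - z‖ ≤ 4 := (norm_sub_le _ _).trans (by linarith)
  rw [mul_comm]
  gcongr

variable {n m : ℕ}

/-- For almost every base point of the lattice the increments of a continuous Sobolev map along all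
lattice segments are `n`-summable. -/
lemma MemSobolevOne.exists_tsum_segmentIncrement_ne_top (hn : 1 ≤ n)
    {f : EuclideanSpace ℝ (Fin n) → EuclideanSpace ℝ (Fin m)}
    (hf : MemSobolevOne (n : ℝ≥0∞) (ball 0 1) f) (hcont : ContinuousOn f (ball 0 1))
    {b : Basis (Fin n) ℝ (EuclideanSpace ℝ (Fin n))} (hb : ∑ i, ‖b i‖ ≤ 1)
    {L : Set (EuclideanSpace ℝ (Fin n))} (hL : L.Finite) (hL2 : ∀ l ∈ L, ‖l‖ ≤ 2) :
    ∃ z ∈ ZSpan.fundamentalDomain b, ∑' p : L × (ℕ × span ℤ (range b)),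
      segmentIncrement b ((ball 0 1).indicator f) (dyadicAnnulus _ p.2.1) p.2.1 p.2.2 p.1 z
        ≠ ⊤ := by
  obtain ⟨K, hK, happrox⟩ := hf.exists_contDiff_approx hn hcont
  have hcount : Countable (span ℤ (range b)) := inferInstance
  have hmeas : Measurable ((ball (0 : EuclideanSpace ℝ (Fin n)) 1).indicator f) := by
    classical
    rw [← piecewise_eq_indicator]
    exact hcont.measurable_piecewise continuousOn_const measurableSet_ball
  have hD := ZSpan.fundamentalDomain_measurableSet b
  have hfin := hL.fintype
  have hrank : finrank ℝ (EuclideanSpace ℝ (Fin n)) = n := finrank_euclideanSpace_fin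
  -- A finite integral makes the sum finite for almost every z, simultaneously for the finitely many
  -- l; the cell has positive measure, so a good z exists.
  have hae : ∀ᵐ z ∂(volume.restrict (ZSpan.fundamentalDomain b)), ∀ l : L,
      ∑' p : ℕ × span ℤ (range b), segmentIncrement b ((ball 0 1).indicator f)
        (dyadicAnnulus _ p.1) p.1 p.2 l z < ⊤ := by
    refine ae_all_iff.2 fun l => ?_
    refine ae_lt_top ?_ (ne_top_of_le_ne_top ?_ (lintegral_tsum_segmentIncrement_le volume b
      (by rwa [hrank]) (fun z hz => (ZSpan.norm_le_of_mem_fundamentalDomain b hz).trans hb) hmeas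
      (K := K) (by simpa only [hrank] using happrox) (hL2 l l.2)))
    · exact Measurable.tsum fun p => measurable_segmentIncrement b hmeas _ _ _ _
    · finiteness
  have hne : (ae (volume.restrict (ZSpan.fundamentalDomain b))).NeBot := by
    rw [ae_neBot, Ne, Measure.restrict_eq_zero]
    exact ZSpan.measure_fundamentalDomain_ne_zero b
  obtain ⟨z, hz, hzD⟩ := (hae.and (ae_restrict_mem hD)).exists
  refine ⟨z, hzD, ?_⟩
  rw [ENNReal.tsum_prod', tsum_fintype]
  exact ENNReal.sum_ne_top.2 fun l _ => (hz l).ne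

end Assembly

open Module Submodule Filter Topology in
theorem theorem1p2 (n m : ℕ) (hn : 1 ≤ n) (γ C₀ : ℝ) (hγ_pos : 0 < γ) (hγ_le : γ ≤ 1)
    (hC₀ : 0 < C₀)
    (f : EuclideanSpace ℝ (Fin n) → EuclideanSpace ℝ (Fin m))
    (hf : MemSobolevOne (n : ℝ≥0∞) (ball 0 1) f)
    (hHolder : ∀ z ∈ ball (0 : EuclideanSpace ℝ (Fin n)) 1,
      ∀ w ∈ ball (0 : EuclideanSpace ℝ (Fin n)) 1, ‖f z - f w‖ ≤ C₀ * ‖z - w‖ ^ γ) :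
    ∃ F : EuclideanSpace ℝ (Fin n) → EuclideanSpace ℝ (Fin m),
      ContinuousOn F (closedBall 0 1) ∧ EqOn F f (ball 0 1) ∧
      gaugeHausdorffMeasure m (fun t => t ^ n * Real.log (1 / t)) (F '' sphere 0 1) = 0 := by
  set B := ball (0 : EuclideanSpace ℝ (Fin n)) 1 with hB
  have huc := uniformContinuousOn_of_norm_sub_le_rpow hC₀ hγ_pos hHolder
  have hclos : closure B = closedBall 0 1 := closure_ball _ one_ne_zero
  have hlim : ∀ x ∈ closedBall (0 : EuclideanSpace ℝ (Fin n)) 1,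
      ∃ y, Tendsto f (𝓝[B] x) (𝓝 y) := fun x hx =>
    huc.exists_tendsto_nhdsWithin (hclos ▸ hx)
  refine ⟨extendFrom B f, continuousOn_extendFrom hclos.ge hlim, fun x hx =>
    extendFrom_eq (subset_closure hx) (huc.continuousOn x hx), ?_⟩
  obtain ⟨b, hb⟩ := EuclideanSpace.exists_basis_sum_norm_le n (ε := 1 / 16) (by norm_num)
  have hb1 : ∑ i, ‖b i‖ ≤ 1 := hb.trans (by norm_num)
  set L : Set (EuclideanSpace ℝ (Fin n)) := closedBall 0 2 ∩ span ℤ (range b)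
  have hL : L.Finite := ZSpan.setFinite_inter b isBounded_closedBall
  obtain ⟨z, hz, hsum⟩ := hf.exists_tsum_segmentIncrement_ne_top hn huc.continuousOn hb1 hL
    fun l hl => mem_closedBall_zero_iff.1 hl.1
  set f₁ := B.indicator f with hf₁
  have hff₁ : ∀ x ∈ B, f₁ x = f x := fun x hx => indicator_of_mem hx f
  have hsub : ∀ j, dyadicAnnulus (EuclideanSpace ℝ (Fin n)) j ⊆ B := fun j x hx => by
    have h1 := hx.1
    have h2 : (0 : ℝ) < 1 / 4 * (1 / 2) ^ j := by positivity
    rw [hB, mem_ball_zero_iff]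
    linarith
  have hcount : Countable (span ℤ (range b)) := inferInstance
  have hcountL : Countable L := hL.countable
  classical
  -- The index `none` is the common root z of all chains, with artificial increment 1; a segment of
  -- generation j is a vertex of level j + 1, placed at its far endpoint.
  let c : Option (L × (ℕ × span ℤ (range b))) → EuclideanSpace ℝ (Fin m) := fun o =>
    o.elim (f₁ z) fun p => f₁ (latticeSegment p.2.1 p.2.2 p.1 z 1)
  let d : Option (L × (ℕ × span ℤ (range b))) → ℝ := fun o =>
    o.elim 1 fun p => if SegmentsSubset b (dyadicAnnulus _ p.2.1) p.2.1 p.2.2 p.1 then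
      ‖f₁ (latticeSegment p.2.1 p.2.2 p.1 z 1) - f₁ (latticeSegment p.2.1 p.2.2 p.1 z 0)‖ else 0
  refine gaugeHausdorffMeasure_eq_zero_of_chains hn (fun o => o.elim 0 fun p => p.2.1 + 1) c d ?_
    -- In C, the summand 1 serves the root and C₀ * 4 ^ γ comes from the Hölder bound.
    (w := (1 / 2 : ℝ) ^ (γ / 2)) (C := 1 + C₀ * 4 ^ γ) (by positivity)
    (Real.rpow_lt_one (by norm_num) (by norm_num) (by positivity)) ?_ ?_
  · have hd : ∀ p, ENNReal.ofReal (d (some p) ^ n) =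
        segmentIncrement b f₁ (dyadicAnnulus _ p.2.1) p.2.1 p.2.2 p.1 z := by
      intro p
      by_cases h : SegmentsSubset b (dyadicAnnulus _ p.2.1) p.2.1 p.2.2 (p.1 : _)
      · rw [segmentIncrement_of_subset b h, finrank_euclideanSpace_fin, ← ofReal_norm,
          ← ENNReal.ofReal_pow (norm_nonneg _)]
        simp [d, h]
      · rw [segmentIncrement_of_not_subset b h]
        simp [d, h, show n ≠ 0 by omega]
    rw [← (Equiv.optionEquivSumPUnit.{0} _).symm.tsum_eq, Summable.tsum_sum ENNReal.summable
      ENNReal.summable, add_comm]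
    simp only [Equiv.optionEquivSumPUnit_symm_inl, Equiv.optionEquivSumPUnit_symm_inr, hd,
      tsum_fintype, Finset.univ_unique, Finset.sum_singleton]
    exact ENNReal.add_ne_top.2 ⟨ENNReal.ofReal_ne_top, hsum⟩
  · rintro (_ | ⟨⟨l, hl⟩, j, k⟩)
    · simp only [d, Option.elim_none, pow_zero, mul_one]
      linarith [show 0 ≤ C₀ * 4 ^ γ by positivity]
    simp only [d, Option.elim_some]
    split_ifs with h
    · have h₀ := hsub j (h z hz 0 (by simp))
      have h₁ := hsub j (h z hz 1 (by simp))
      rw [hff₁ _ h₀, hff₁ _ h₁]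
      refine (norm_sub_latticeSegment_le_of_holder hC₀ hγ_pos hHolder
        (mem_closedBall_zero_iff.1 hl.1)
        ((ZSpan.norm_le_of_mem_fundamentalDomain b hz).trans hb1) h₀ h₁).trans ?_
      gcongr
      linarith
    · positivity
  · rintro _ ⟨ξ, hξ, rfl⟩
    rw [mem_sphere_zero_iff_norm] at hξ
    have hray := fun j => segmentsSubset_ray hb hξ j
    -- The chain of ξ starts at the root and then takes the segments along its ray; their steps lie
    -- in L.
    let q : ℕ → Option (L × (ℕ × span ℤ (range b))) := fun j => j.casesOn none fun j =>
      some (⟨rayStep b ξ j, mem_closedBall_zero_iff.2 (norm_rayStep_le hb hξ j),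
        rayStep_mem b ξ j⟩, j, rayCell b ξ j)
    have hc : ∀ j, c (q j) = f₁ ((1 / 2 : ℝ) ^ j • ((rayCell b ξ j : EuclideanSpace ℝ (Fin n)) + z))
      | 0 => by simp [c, q, rayCell_zero]
      | j + 1 => congrArg f₁ (latticeSegment_ray_one b ξ z j)
    refine ⟨q, fun j => by cases j <;> rfl, le_rfl, fun j => ?_, ?_⟩
    · rw [hc j, hc (j + 1), ← latticeSegment_ray_one, ← latticeSegment_ray_zero]
      simp only [d, q, Option.elim_some, hray, if_true, le_refl]
    · have hmem : ∀ j : ℕ, (1 / 2 : ℝ) ^ j • ((rayCell b ξ j : EuclideanSpace ℝ (Fin n)) + z) ∈ B := by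
        intro j
        rw [← latticeSegment_ray_zero]
        exact hsub j (hray j z hz 0 (by simp))
      have h1 : Tendsto f (𝓝[B] ξ) (𝓝 (extendFrom B f ξ)) :=
        tendsto_extendFrom (hlim ξ (mem_closedBall_zero_iff.2 hξ.le))
      refine (h1.comp (tendsto_nhdsWithin_iff.2 ⟨tendsto_smul_rayCell_add hb ξ hz,
        Eventually.of_forall hmem⟩)).congr fun j => ?_
      rw [hc, hff₁ _ (hmem j)]
      rfl
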